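/- Let $K$ be a totally real number field with ring of integers $\mathfrak{o}$, and let $V$ be a $2$-dimensional $K$-vector space with a non-degenerate symmetric bilinear form $B\colon V\times V\to K$ that is totally positive, i.e. the induced form on $V_{\mathfrak p}=V\otimes_K K_{\mathfrak p}$ is positive definite for every archimedean place $\mathfrak p$ of $K$. Let $L$ be a lattice in $V$, i.e. a finitely generated $\mathfrak{o}$-submodule of $V$ that spans $V$ over $K$. Then for every integer $h\ge 1$ there are only finitely many shifted lattices of the form $X=L+\nu$ with $\nu\in V$ (counted as subsets of $V$) such that $h^{+}(X)=h$. Here a shifted lattice in $V$ is a subset $M+\mu$ with $M$ a lattice in $V$ and $\mu\in V$. Its localization at a place $\mathfrak p$ is $M_{\mathfrak p}+\mu\subseteq V_{\mathfrak p}$, where $M_{\mathfrak p}$ is the $\mathfrak{o}_{\mathfrak p}$-submodule of $V_{\mathfrak p}$ generated by $M$, and $\mathfrak{o}_{\mathfrak p}$ is the ring of integers of $K_{\mathfrak p}$ (with $\mathfrak{o}_{\mathfrak p}=K_{\mathfrak p}$ if $\mathfrak p$ is archimedean). The proper class of a (localized) shifted lattice is its orbit under the group of linear automorphisms of determinant $1$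 of the ambient space that preserve the bilinear form. The proper genus of $X$ is the set of shifted lattices $Y$ in $V$ such that, for every place $\mathfrak p$ of $K$, $Y_{\mathfrak p}$ lies in the proper class of $X_{\mathfrak p}$. The proper class number $h^{+}(X)$ is the number of proper classes in the proper genus of $X$. -/

import Mathlib

open scoped TensorProduct NumberField Pointwise
open IsDedekindDomain NumberField

noncomputable section

namespace ShiftedLattice

/-- The proper orthogonal group `O⁺(W)` of a vector space `W` over a field `F` equipped with a
bilinear form `B`: the linear automorphisms of determinant `1` preserving `B`. -/
def properOrthogonalGroup {F W : Type*} [Field F] [AddCommGroup W] [Module F W]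
    (B : LinearMap.BilinForm F W) : Subgroup (W ≃ₗ[F] W) where
  carrier := {σ | (∀ x y, B (σ x) (σ y) = B x y) ∧ LinearMap.det (σ : W →ₗ[F] W) = 1}
  one_mem' := ⟨fun _ _ => rfl, LinearMap.det_id⟩
  mul_mem' := by
    rintro σ τ ⟨h₁, d₁⟩ ⟨h₂, d₂⟩
    refine ⟨fun x y => ?_, ?_⟩
    · simp only [LinearEquiv.mul_apply, h₁, h₂]
    · have : ((σ * τ : W ≃ₗ[F] W) : W →ₗ[F] W) = (σ : W →ₗ[F] W) * (τ : W →ₗ[F] W) := rfl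
      rw [this, map_mul, d₁, d₂, one_mul]
  inv_mem' := by
    rintro σ ⟨h, d⟩
    refine ⟨fun x y => ?_, ?_⟩
    · rw [← h]
      simp
    · have : ((σ⁻¹ : W ≃ₗ[F] W) : W →ₗ[F] W) * (σ : W →ₗ[F] W) = 1 := by
        ext x
        simp
      have h2 := congrArg LinearMap.det this
      rwa [map_mul, d, mul_one, map_one] at h2

/-- The proper class of a subset `X` of `W`: its orbit under `O⁺(W)`. -/
def properClass {F W : Type*} [Field F] [AddCommGroup W] [Module F W]
    (B : LinearMap.BilinForm F W) (X : Set W) : Set (Set W) :=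
  {Y | ∃ σ ∈ properOrthogonalGroup B, Y = σ '' X}

section Global

variable {K V : Type*} [Field K] [AddCommGroup V] [Module K V] [Module (𝓞 K) V]

/-- The shifted lattice `L + ν`, as a subset of `V`. -/
def shift (L : Submodule (𝓞 K) V) (ν : V) : Set V :=
  {x | ∃ l ∈ L, x = l + ν}

/-- The localization `L_F + ν`, a subset of `V_F = F ⊗ V`, where `F` is an extension of `K` (it
will be the completion at a place), `R` is a subring of `F` (its ring of integers) and `L_F` is
the `R`-submodule of `F ⊗ V` generated by `L`. -/
def localShift {F : Type*} [Field F] [Algebra K F] (R : Subring F)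
    (L : Submodule (𝓞 K) V) (ν : V) : Set (F ⊗[K] V) :=
  {x | ∃ l ∈ Submodule.span R ((fun v : V => (1 : F) ⊗ₜ[K] v) '' (L : Set V)),
    x = l + (1 : F) ⊗ₜ[K] ν}

/-- The localization of `M + μ` at `F` lies in the proper class of the localization of `L + ν`
at `F`, under the proper orthogonal group of the quadratic space `V_F`. -/
def LocallyProperlyEquivalent {F : Type*} [Field F] [Algebra K F] (R : Subring F)
    (B : LinearMap.BilinForm K V) (L : Submodule (𝓞 K) V) (ν : V)
    (M : Submodule (𝓞 K) V) (μ : V) : Prop :=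
  localShift R M μ ∈ properClass (B.baseChange F) (localShift R L ν)

variable [NumberField K] [IsScalarTower (𝓞 K) K V]

/-- The proper genus of the shifted lattice `L + ν`: all shifted lattices `Y = M + μ` in `V` with
`Y_𝔭` in the proper class of `(L + ν)_𝔭` at every place `𝔭` of `K`, non-archimedean or
archimedean. The ring of integers of an archimedean completion is the whole completion. -/
def properGenus (B : LinearMap.BilinForm K V) (L : Submodule (𝓞 K) V) (ν : V) : Set (Set V) :=
  {Y | ∃ (M : Submodule (𝓞 K) V) (μ : V), M.IsLattice K ∧ Y = shift M μ ∧
    (∀ v : HeightOneSpectrum (𝓞 K),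
      LocallyProperlyEquivalent (F := v.adicCompletion K)
        (v.adicCompletionIntegers K).toSubring B L ν M μ) ∧
    (∀ w : InfinitePlace K,
      LocallyProperlyEquivalent (F := w.Completion) ⊤ B L ν M μ)}

/-- The proper class number `h⁺(L + ν)`: the number of proper classes in the proper genus. -/
def properClassNumber (B : LinearMap.BilinForm K V) (L : Submodule (𝓞 K) V) (ν : V) : ℕ∞ :=
  (properClass B '' properGenus B L ν).encard

end Global

/-- For `K` totally real: the quadratic space `(V, B)` (equivalently, every shifted lattice in it)
is totally positive, i.e. the form on `V_w` is positive definite for every archimedean place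
`w`. Positivity in the completion `K_w` is that of its canonical embedding in `ℝ`. -/
def IsTotallyPositive {K V : Type*} [Field K] [NumberField K] [IsTotallyReal K]
    [AddCommGroup V] [Module K V] (B : LinearMap.BilinForm K V) : Prop :=
  ∀ (w : InfinitePlace K) (x : w.Completion ⊗[K] V), x ≠ 0 →
    0 < InfinitePlace.Completion.extensionEmbeddingOfIsReal (IsTotallyReal.isReal w)
      (B.baseChange w.Completion x x)

end ShiftedLattice

end

/-! Since `L` is fixed, it suffices to find a nonzero `e`, depending only on `L` and `h`, with `e •
ν ∈ L` whenever the class number of `L + ν` is `h`: the quotient `L / eL` is finite, so few shifts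
remain.

The plane carries a skew endomorphism `J` with `J² = -d` and `J L ⊆ L`. For integral `t`, the Cayley
transform `σ_t = (1 + tJ)/(1 - tJ)` is a rotation, and it preserves `L` at every finite place `v`
where `1 + t²d` is a unit. Approximation gives a global shift of `L` that agrees with `L + σ_t ν` at
`v` and with `L + ν` at all other places, hence lies in the proper genus (`shift_mem_properGenus`).

By positivity only finitely many rotations preserve `L`. If `G` is the set of these, a genus with
`h` proper classes contains at most `h * |G|` shifts of `L` (`card_le_of_shift_mem_properGenus`). So
among `h * |G| + 1` parameters two satisfy `σ_s ν ≡ σ_t ν` modulo `L` at `v`. As `J (1 - sJ)(1 -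
tJ)(σ_s - σ_t) = 2(t - s)d`, the scalar `2(t - s)d` then kills `ν` modulo `L` at `v`. One parameter
set serves all but finitely many places, so a single `e` works everywhere. -/

namespace ShiftedLattice

/-! ### Clearing denominators into a lattice -/

section Denominators

variable {K V : Type*} [Field K] [AddCommGroup V] [Module K V] [Module (𝓞 K) V]
  [IsScalarTower (𝓞 K) K V]

lemma smul_eq_coe_smul (a : 𝓞 K) (x : V) : a • x = (a : K) • x :=
  (algebraMap_smul K a x).symm

variable [NumberField K]

lemma exists_smul_mem_of_span_eq_top {N : Submodule (𝓞 K) V}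
    (hN : Submodule.span K (N : Set V) = ⊤) (x : V) : ∃ m : 𝓞 K, m ≠ 0 ∧ m • x ∈ N := by
  have hx : x ∈ Submodule.span K (N : Set V) := hN ▸ Submodule.mem_top
  induction hx using Submodule.span_induction with
  | mem x hx => exact ⟨1, one_ne_zero, by simpa using hx⟩
  | zero => exact ⟨1, one_ne_zero, by simp⟩
  | add x y _ _ hx hy =>
    obtain ⟨m, hm, hmx⟩ := hx
    obtain ⟨n, hn, hny⟩ := hy
    refine ⟨m * n, mul_ne_zero hm hn, ?_⟩
    rw [smul_add, mul_smul, mul_smul, smul_comm m n x]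
    exact N.add_mem (N.smul_mem _ hmx) (N.smul_mem _ hny)
  | smul c x _ hx =>
    obtain ⟨m, hm, hmx⟩ := hx
    obtain ⟨a, b, hb, rfl⟩ := IsFractionRing.div_surjective (A := 𝓞 K) c
    have hb0 : (b : K) ≠ 0 := by
      simpa using nonZeroDivisors.ne_zero hb
    refine ⟨b * m, mul_ne_zero (nonZeroDivisors.ne_zero hb) hm, ?_⟩
    have : (b * m) • ((a : K) / (b : K)) • x = a • m • x := by
      simp only [smul_eq_coe_smul, smul_smul, map_mul]
      congr 1
      field_simp
    rw [this]
    exact N.smul_mem _ hmx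

lemma exists_smul_mem_of_fg {N : Submodule (𝓞 K) V}
    (hN : Submodule.span K (N : Set V) = ⊤) {M : Submodule (𝓞 K) V} (hM : M.FG) :
    ∃ m : 𝓞 K, m ≠ 0 ∧ ∀ x ∈ M, m • x ∈ N := by
  induction M, hM using Submodule.fg_induction with
  | singleton x =>
    obtain ⟨m, hm, hmx⟩ := exists_smul_mem_of_span_eq_top hN x
    refine ⟨m, hm, fun y hy => ?_⟩
    obtain ⟨a, rfl⟩ := Submodule.mem_span_singleton.mp hy
    rw [smul_comm]
    exact N.smul_mem _ hmx
  | sup M₁ M₂ _ _ h₁ h₂ =>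
    obtain ⟨m, hm, hmx⟩ := h₁
    obtain ⟨n, hn, hny⟩ := h₂
    refine ⟨m * n, mul_ne_zero hm hn, fun z hz => ?_⟩
    obtain ⟨x, hx, y, hy, rfl⟩ := Submodule.mem_sup.mp hz
    rw [smul_add, mul_smul, mul_smul, smul_comm m n x]
    exact N.add_mem (N.smul_mem _ (hmx x hx)) (N.smul_mem _ (hny y hy))

/-- Rescaling the vectors of an orthogonal basis of `V` into `L` keeps them orthogonal. -/
lemma exists_orthogonal_basis_mem (hdim : Module.finrank K V = 2) {B : LinearMap.BilinForm K V}
    (hsymm : B.IsSymm) {L : Submodule (𝓞 K) V} (hL : Submodule.span K (L : Set V) = ⊤) :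
    ∃ e : Module.Basis (Fin 2) K V, (∀ i, e i ∈ L) ∧ B (e 0) (e 1) = 0 ∧ B (e 1) (e 0) = 0 := by
  have : FiniteDimensional K V := FiniteDimensional.of_finrank_pos (by omega)
  let _ : Invertible (2 : K) := invertibleOfNonzero two_ne_zero
  obtain ⟨v, hv⟩ := LinearMap.BilinForm.exists_orthogonal_basis (B := B) ⟨fun x y => hsymm.eq x y⟩
  let w : Module.Basis (Fin 2) K V := v.reindex (finCongr hdim)
  have hw : ∀ i j, i ≠ j → B (w i) (w j) = 0 := fun i j hij => by
    simpa [w] using hv (i := (finCongr hdim).symm i) (j := (finCongr hdim).symm j) (by simpa using hij)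
  choose m hm hmL using fun i => exists_smul_mem_of_span_eq_top hL (w i)
  refine ⟨w.isUnitSMul (w := fun i => (m i : K)) fun i => ?_, fun i => ?_, ?_, ?_⟩
  · exact isUnit_iff_ne_zero.mpr (by simpa using hm i)
  · rw [Module.Basis.isUnitSMul_apply, ← smul_eq_coe_smul]
    exact hmL i
  · simp [Module.Basis.isUnitSMul_apply, hw 0 1 (by decide)]
  · simp [Module.Basis.isUnitSMul_apply, hw 1 0 (by decide)]

end Denominators

/-! ### Finiteness from total positivity -/

section Positivity

variable {K V : Type*} [Field K] [NumberField K] [IsTotallyReal K] [AddCommGroup V] [Module K V]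

lemma IsTotallyPositive.exists_ringHom_real {B : LinearMap.BilinForm K V}
    (hB : IsTotallyPositive B) (w : InfinitePlace K) :
    ∃ ψ : K →+* ℝ, (∀ y, w y = |ψ y|) ∧ ∀ x, x ≠ 0 → 0 < ψ (B x x) := by
  refine ⟨InfinitePlace.embedding_of_isReal (IsTotallyReal.isReal w), fun y => ?_, fun x hx => ?_⟩
  · rw [← InfinitePlace.norm_embedding_of_isReal (IsTotallyReal.isReal w), Real.norm_eq_abs]
  · have hx' : (1 : w.Completion) ⊗ₜ[K] x ≠ 0 := by
      intro h
      refine hx ((Module.FaithfullyFlat.tensorProduct_mk_injective (A := K) (B := w.Completion) V)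
        ?_)
      simpa using h
    have := hB w _ hx'
    rw [LinearMap.BilinForm.baseChange_tmul, mul_one, Algebra.smul_def, mul_one] at this
    rw [InfinitePlace.Completion.algebraMap_apply] at this
    exact this.trans_eq (InfinitePlace.Completion.extensionEmbeddingOfIsReal_coe _
      ((WithAbs.equiv w.1).symm (B x x)))

lemma IsTotallyPositive.self_ne_zero {B : LinearMap.BilinForm K V}
    (hB : IsTotallyPositive B) {x : V} (hx : x ≠ 0) : B x x ≠ 0 := by
  intro h
  obtain ⟨ψ, -, hψ⟩ := hB.exists_ringHom_real (Classical.arbitrary (InfinitePlace K))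
  simpa [h] using hψ x hx

variable [Module (𝓞 K) V] [IsScalarTower (𝓞 K) K V]

/-- In an orthogonal basis, positivity at each real place bounds each coordinate by `B x x`. The
coordinates have a common denominator `m`, and only finitely many algebraic integers of `K` have all
conjugates bounded. -/
lemma IsTotallyPositive.finite_setOf_mem_apply_self_eq {B : LinearMap.BilinForm K V}
    (hB : IsTotallyPositive B) {e : Module.Basis (Fin 2) K V} (h01 : B (e 0) (e 1) = 0)
    (h10 : B (e 1) (e 0) = 0) {L : Submodule (𝓞 K) V} (hL : L.FG) (c : K) :
    {x | x ∈ L ∧ B x x = c}.Finite := by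
  obtain ⟨m, hm, hmL⟩ := exists_smul_mem_of_fg
    (N := Submodule.span (𝓞 K) (Set.range e)) (by
      rw [Submodule.span_span_of_tower, e.span_eq]) hL
  -- The bound obtained is on `u ^ 2`, and `u ≤ u ^ 2 + 1` turns it into one on `u`. Summing over
  -- places and indices makes it uniform.
  let C : ℝ := ∑ w : InfinitePlace K, ∑ i : Fin 2, (w m ^ 2 * (w c / w (B (e i) (e i))) + 1)
  have hfin := Embeddings.finite_of_norm_le K ℂ C
  refine Set.Finite.of_injOn (f := fun x i => (m : K) * e.repr x i)
    (t := Set.univ.pi fun _ => {x : K | IsIntegral ℤ x ∧ ∀ φ : K →+* ℂ, ‖φ x‖ ≤ C}) ?_ ?_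
    (Set.Finite.pi fun _ => hfin)
  · rintro x ⟨hx, hxc⟩ i -
    refine ⟨?_, fun φ => ?_⟩
    · obtain ⟨a, ha⟩ := (e.mem_span_iff_repr_mem (𝓞 K) _).mp (hmL x hx) i
      rw [smul_eq_coe_smul, map_smul, Finsupp.smul_apply, smul_eq_mul] at ha
      change IsIntegral ℤ ((m : K) * e.repr x i)
      rw [← ha]
      exact RingOfIntegers.isIntegral_coe a
    · change ‖φ ((m : K) * e.repr x i)‖ ≤ C
      rw [← InfinitePlace.apply]
      set w := InfinitePlace.mk φ
      obtain ⟨ψ, hw, hψ⟩ := hB.exists_ringHom_real w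
      have hexp : e.repr x 0 ^ 2 * B (e 0) (e 0) + e.repr x 1 ^ 2 * B (e 1) (e 1) = c := by
        have h := e.sum_repr x
        rw [Fin.sum_univ_two] at h
        rw [← hxc]
        conv_rhs => rw [← h]
        simp [h01, h10]
        ring
      have hle : ψ (e.repr x i) ^ 2 * ψ (B (e i) (e i)) ≤ ψ c := by
        rw [← hexp]
        have h0 := hψ (e 0) (e.ne_zero 0)
        have h1 := hψ (e 1) (e.ne_zero 1)
        simp only [map_add, map_mul, map_pow]
        fin_cases i
        · have := mul_nonneg (sq_nonneg (ψ (e.repr x 1))) h1.le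
          simpa using this
        · have := mul_nonneg (sq_nonneg (ψ (e.repr x 0))) h0.le
          simpa using this
      have hi := hψ (e i) (e.ne_zero i)
      have hc : 0 ≤ ψ c := (mul_nonneg (sq_nonneg _) hi.le).trans hle
      have hsq : w ((m : K) * e.repr x i) ^ 2 ≤ w m ^ 2 * (w c / w (B (e i) (e i))) := by
        rw [map_mul, mul_pow]
        refine mul_le_mul_of_nonneg_left ?_ (sq_nonneg _)
        rw [hw (e.repr x i), hw c, hw (B (e i) (e i)), abs_of_nonneg hc, abs_of_pos hi, sq_abs,
          le_div_iff₀ hi]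
        exact hle
      have hterm : ∀ (v : InfinitePlace K) (j : Fin 2),
          0 ≤ v m ^ 2 * (v c / v (B (e j) (e j))) + 1 := fun v j =>
        add_nonneg (mul_nonneg (sq_nonneg _) (div_nonneg (apply_nonneg v _) (apply_nonneg v _)))
          zero_le_one
      calc w ((m : K) * e.repr x i)
          ≤ w m ^ 2 * (w c / w (B (e i) (e i))) + 1 := by
            nlinarith [sq_nonneg (w ((m : K) * e.repr x i) - 1)]
        _ ≤ ∑ j : Fin 2, (w m ^ 2 * (w c / w (B (e j) (e j))) + 1) :=
            Finset.single_le_sum (f := fun j => w m ^ 2 * (w c / w (B (e j) (e j))) + 1)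
              (fun j _ => hterm w j) (Finset.mem_univ i)
        _ ≤ C := Finset.single_le_sum
              (f := fun v : InfinitePlace K => ∑ j : Fin 2, (v m ^ 2 * (v c / v (B (e j) (e j))) + 1))
              (fun v _ => Finset.sum_nonneg fun j _ => hterm v j) (Finset.mem_univ w)
  · intro x _ y _ hxy
    refine e.ext_elem fun i => ?_
    have hm' : (m : K) ≠ 0 := by simpa using hm
    exact mul_left_cancel₀ hm' (congrFun hxy i)

/-- Such a `τ` is determined by the images of a basis in `L`, which are vectors of `L` of prescribed
length. -/
lemma IsTotallyPositive.finite_setOf_properOrthogonalGroup_mem {B : LinearMap.BilinForm K V}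
    (hB : IsTotallyPositive B) (hdim : Module.finrank K V = 2) (hsymm : B.IsSymm)
    {L : Submodule (𝓞 K) V} (hL : L.IsLattice K) :
    {τ | τ ∈ properOrthogonalGroup B ∧ ∀ l ∈ L, τ l ∈ L}.Finite := by
  obtain ⟨e, heL, h01, h10⟩ := exists_orthogonal_basis_mem hdim hsymm hL.span_eq_top
  refine Set.Finite.of_injOn (f := fun (τ : V ≃ₗ[K] V) i => τ (e i))
    (t := Set.univ.pi fun i => {x | x ∈ L ∧ B x x = B (e i) (e i)}) ?_ ?_
    (Set.Finite.pi fun i => hB.finite_setOf_mem_apply_self_eq h01 h10 hL.fg _)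
  · rintro τ ⟨hτ, hτL⟩ i -
    exact ⟨hτL _ (heL i), hτ.1 _ _⟩
  · intro σ _ τ _ h
    exact e.ext' fun i => congrFun h i

end Positivity

/-! ### Rotations from Cayley transforms -/

section Cayley

variable {K V : Type*} [Field K] [AddCommGroup V] [Module K V] [Module (𝓞 K) V]

/-- An endomorphism `J` of a binary quadratic space that is skew with respect to `B`, preserves the
lattice `L`, and satisfies `J² = -d` with `d` a nonzero algebraic integer. -/
structure SkewEndomorphism (B : LinearMap.BilinForm K V) (L : Submodule (𝓞 K) V) where
  /-- The underlying endomorphism. -/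
  J : V →ₗ[K] V
  /-- The negative of its square. -/
  d : 𝓞 K
  d_ne_zero : d ≠ 0
  skew : ∀ x y, B (J x) y = -B x (J y)
  sq : J * J = -((d : K) • 1)
  map_mem : ∀ l ∈ L, J l ∈ L
  det_add : ∀ p q : K, LinearMap.det (p • (1 : V →ₗ[K] V) + q • J) = p ^ 2 + q ^ 2 * d

namespace SkewEndomorphism

variable {B : LinearMap.BilinForm K V} {L : Submodule (𝓞 K) V} (S : SkewEndomorphism B L)

/-- The norm `1 + t² d` of `1 + t J`. -/
def norm (t : 𝓞 K) : 𝓞 K := 1 + t ^ 2 * S.d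

lemma norm_neg (t : 𝓞 K) : S.norm (-t) = S.norm t := by
  simp [norm]

lemma coe_norm (t : 𝓞 K) : (S.norm t : K) = 1 + (t : K) ^ 2 * S.d := by
  simp [norm]

/-- The endomorphism `1 + t J`. -/
def linear (t : 𝓞 K) : V →ₗ[K] V := 1 + (t : K) • S.J

lemma linear_apply (t : 𝓞 K) (x : V) : S.linear t x = x + (t : K) • S.J x := rfl

lemma J_J (x : V) : S.J (S.J x) = -((S.d : K) • x) :=
  LinearMap.congr_fun S.sq x

lemma linear_mul_linear_neg (t : 𝓞 K) :
    S.linear t * S.linear (-t) = (S.norm t : K) • 1 := by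
  ext x
  simp only [linear_apply, Module.End.mul_apply, map_add, map_smul, S.J_J, S.coe_norm,
    LinearMap.smul_apply, Module.End.one_apply, map_neg]
  module

lemma linear_mul_comm (s t : 𝓞 K) : S.linear s * S.linear t = S.linear t * S.linear s := by
  ext x
  simp only [linear_apply, Module.End.mul_apply, map_add, map_smul, S.J_J]
  module

lemma apply_linear_left (t : 𝓞 K) (x y : V) :
    B (S.linear t x) y = B x (S.linear (-t) y) := by
  simp [linear_apply, S.skew, Algebra.smul_def]

lemma det_linear (t : 𝓞 K) : LinearMap.det (S.linear t) = S.norm t := by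
  have := S.det_add 1 t
  rw [one_smul] at this
  rw [linear, this, S.coe_norm, one_pow]

/-- The Cayley transform `(1 + t J)² / (1 + t² d) = (1 + t J) / (1 - t J)`. -/
def cayley (t : 𝓞 K) : V →ₗ[K] V := (S.norm t : K)⁻¹ • (S.linear t * S.linear t)

lemma cayley_mul_cayley_neg {t : 𝓞 K} (ht : S.norm t ≠ 0) : S.cayley t * S.cayley (-t) = 1 := by
  have ht' : (S.norm t : K) ≠ 0 := by simpa using ht
  have : S.linear t * S.linear t * (S.linear (-t) * S.linear (-t)) =
      ((S.norm t : K) * S.norm t) • 1 := by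
    rw [mul_assoc, ← mul_assoc (S.linear t) (S.linear (-t)), linear_mul_linear_neg, smul_mul_assoc,
      one_mul, mul_smul_comm, linear_mul_linear_neg, smul_smul]
  rw [cayley, cayley, norm_neg, smul_mul_smul_comm, this, smul_smul]
  field_simp
  simp

/-- The Cayley transform as a linear automorphism. -/
def cayleyEquiv {t : 𝓞 K} (ht : S.norm t ≠ 0) : V ≃ₗ[K] V :=
  LinearEquiv.ofLinearMap (S.cayley t) (S.cayley (-t)) (S.cayley_mul_cayley_neg ht) (by
    have := S.cayley_mul_cayley_neg (t := -t) (by rwa [norm_neg])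
    rwa [neg_neg] at this)

lemma cayleyEquiv_apply {t : 𝓞 K} (ht : S.norm t ≠ 0) (x : V) :
    S.cayleyEquiv ht x = S.cayley t x := rfl

lemma cayleyEquiv_symm_apply {t : 𝓞 K} (ht : S.norm t ≠ 0) (x : V) :
    (S.cayleyEquiv ht).symm x = S.cayley (-t) x := rfl

lemma apply_cayley_left (t : 𝓞 K) (x y : V) :
    B (S.cayley t x) y = B x (S.cayley (-t) y) := by
  simp [cayley, apply_linear_left, norm_neg]

/-- The adjoint of `cayley t` is `cayley (-t)`, which is also its inverse. The determinant is `1`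
because, in dimension two, the scalar `(norm t)⁻¹` contributes its square. -/
lemma cayleyEquiv_mem (hdim : Module.finrank K V = 2) {t : 𝓞 K} (ht : S.norm t ≠ 0) :
    S.cayleyEquiv ht ∈ properOrthogonalGroup B := by
  have ht' : (S.norm t : K) ≠ 0 := by simpa using ht
  refine ⟨fun x y => ?_, ?_⟩
  · rw [cayleyEquiv_apply, apply_cayley_left, ← cayleyEquiv_symm_apply S ht,
      LinearEquiv.symm_apply_apply]
  · change LinearMap.det (S.cayley t) = 1
    rw [cayley, LinearMap.det_smul, hdim, map_mul, det_linear]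
    field_simp

lemma linear_mem [IsScalarTower (𝓞 K) K V] (t : 𝓞 K) {x : V} (hx : x ∈ L) : S.linear t x ∈ L := by
  rw [linear_apply, ← smul_eq_coe_smul]
  exact L.add_mem hx (L.smul_mem _ (S.map_mem x hx))

lemma norm_smul_cayley {t : 𝓞 K} [IsScalarTower (𝓞 K) K V] (ht : S.norm t ≠ 0) (x : V) :
    S.norm t • S.cayley t x = S.linear t (S.linear t x) := by
  have ht' : (S.norm t : K) ≠ 0 := by simpa using ht
  rw [smul_eq_coe_smul, cayley, LinearMap.smul_apply, smul_inv_smul₀ ht', Module.End.mul_apply]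

lemma linear_neg_cayley {t : 𝓞 K} (ht : S.norm t ≠ 0) (x : V) :
    S.linear (-t) (S.cayley t x) = S.linear t x := by
  have ht' : (S.norm t : K) ≠ 0 := by simpa using ht
  have h : S.linear (-t) * S.linear t = (S.norm t : K) • 1 := by
    rw [linear_mul_comm, linear_mul_linear_neg]
  have h2 : S.linear (-t) * S.cayley t = S.linear t := by
    rw [cayley, mul_smul_comm, ← mul_assoc, h, smul_mul_assoc, one_mul, inv_smul_smul₀ ht']
  exact LinearMap.congr_fun h2 x

/-- Clearing the denominators `1 - sJ` and `1 - tJ` leaves `(1 - tJ)(1 + sJ) - (1 - sJ)(1 + tJ) =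
2(s - t)J`, and a further `J` makes it a scalar. All factors applied preserve `L`. -/
lemma J_linear_linear_cayley_sub {s t : 𝓞 K} (hs : S.norm s ≠ 0) (ht : S.norm t ≠ 0) (x : V) :
    S.J (S.linear (-s) (S.linear (-t) (S.cayley s x - S.cayley t x))) =
      (2 * (t - s) * S.d : K) • x := by
  have hc : ∀ y, S.linear (-s) (S.linear (-t) y) = S.linear (-t) (S.linear (-s) y) := fun y =>
    LinearMap.congr_fun (S.linear_mul_comm (-s) (-t)) y
  rw [map_sub, map_sub, S.linear_neg_cayley ht, hc, S.linear_neg_cayley hs]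
  simp only [linear_apply, map_sub, map_add, map_smul, J_J, map_neg, smul_neg]
  module

end SkewEndomorphism

lemma exists_skewEndomorphism [NumberField K] [IsTotallyReal K] [IsScalarTower (𝓞 K) K V]
    (hdim : Module.finrank K V = 2) {B : LinearMap.BilinForm K V} (hsymm : B.IsSymm)
    (hB : IsTotallyPositive B) {L : Submodule (𝓞 K) V} (hL : L.IsLattice K) :
    Nonempty (SkewEndomorphism B L) := by
  obtain ⟨e, -, h01, h10⟩ := exists_orthogonal_basis_mem hdim hsymm hL.span_eq_top
  set a := B (e 0) (e 0) with ha
  set b := B (e 1) (e 1) with hb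
  have ha0 : a ≠ 0 := hB.self_ne_zero (e.ne_zero 0)
  have hb0 : b ≠ 0 := hB.self_ne_zero (e.ne_zero 1)
  -- A scaled quarter turn, with square `-ab`.
  let J₀ : V →ₗ[K] V := e.constr K ![a • e 1, -(b • e 0)]
  have hJ0 : J₀ (e 0) = a • e 1 := by simp [J₀]
  have hJ1 : J₀ (e 1) = -(b • e 0) := by simp [J₀]
  obtain ⟨m, hm, hmL⟩ := exists_smul_mem_of_fg hL.span_eq_top
    (hL.fg.map (J₀.restrictScalars (𝓞 K)))
  obtain ⟨r, q, hq, hrq⟩ := IsFractionRing.div_surjective (A := 𝓞 K) (a * b)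
  have hq0 : q ≠ 0 := nonZeroDivisors.ne_zero hq
  have hq0' : (q : K) ≠ 0 := by simpa using hq0
  have hr : (r : K) = a * b * q := by rw [← hrq]; field_simp
  have hr0 : r ≠ 0 := by
    rintro rfl
    rw [map_zero, zero_div] at hrq
    exact mul_ne_zero ha0 hb0 hrq.symm
  have hsq : ∀ x, J₀ (J₀ x) = -((a * b) • x) := by
    intro x
    have : J₀ * J₀ = -((a * b) • 1) := by
      refine e.ext fun i => ?_
      fin_cases i
      · simp [hJ0, hJ1, smul_smul]
      · simp [hJ0, hJ1, smul_smul, mul_comm]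
    simpa using LinearMap.congr_fun this x
  -- The factor `m` carries `J₀ L` into `L`; the factor `q`, a denominator of `ab`, makes `d =
  -- (mq)²ab = m²qr` integral.
  refine ⟨⟨((m : K) * q) • J₀, m ^ 2 * q * r, ?_, ?_, ?_, ?_, ?_⟩⟩
  · exact mul_ne_zero (mul_ne_zero (pow_ne_zero 2 hm) hq0) hr0
  · intro x y
    suffices B (J₀ x) y = -B x (J₀ y) by simp [this]
    have h : B.comp J₀ LinearMap.id = -B.comp LinearMap.id J₀ := by
      refine LinearMap.BilinForm.ext_basis e fun i j => ?_
      fin_cases i <;> fin_cases j <;> simp [hJ0, hJ1, h01, h10, ← ha, ← hb, mul_comm]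
    simpa using LinearMap.congr_fun₂ h x y
  · ext x
    simp only [Module.End.mul_apply, LinearMap.smul_apply, map_smul, hsq, LinearMap.neg_apply,
      Module.End.one_apply, smul_neg, smul_smul, map_mul, map_pow, hr]
    congr 2
    ring
  · intro l hl
    rw [LinearMap.smul_apply, mul_comm, mul_smul, ← smul_eq_coe_smul, ← smul_eq_coe_smul]
    exact L.smul_mem _ (hmL _ ⟨l, hl, rfl⟩)
  · intro p s
    rw [← LinearMap.det_toMatrix e, Matrix.det_fin_two]
    simp [LinearMap.toMatrix_apply, hJ0, hJ1, hr]
    ring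

end Cayley

/-! ### Localization, approximation and membership in the genus -/

section Local

lemma baseChange_mem_properOrthogonalGroup {K V F : Type*} [Field K]
    [AddCommGroup V] [Module K V] [FiniteDimensional K V] [Field F] [Algebra K F]
    {B : LinearMap.BilinForm K V}
    {σ : V ≃ₗ[K] V} (hσ : σ ∈ properOrthogonalGroup B) :
    σ.baseChange K F V V ∈ properOrthogonalGroup (B.baseChange F) := by
  refine ⟨fun x y => ?_, ?_⟩
  · induction x with
    | zero => simp
    | add x₁ x₂ h₁ h₂ => simp only [map_add, LinearMap.add_apply, h₁, h₂]
    | tmul a x =>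
      induction y with
      | zero => simp
      | add y₁ y₂ h₁ h₂ => simp only [map_add, h₁, h₂]
      | tmul b y => simp [hσ.1]
  · have : ((σ.baseChange K F V V : (F ⊗[K] V) ≃ₗ[F] (F ⊗[K] V)) : F ⊗[K] V →ₗ[F] F ⊗[K] V) =
        (σ : V →ₗ[K] V).baseChange F := rfl
    rw [this, LinearMap.det_baseChange, hσ.2, map_one]

variable {K V : Type*} [Field K] [AddCommGroup V] [Module (𝓞 K) V]

/-- The localization of `L` at a finite place, inside the global space `V`. -/
def localizationAt (v : HeightOneSpectrum (𝓞 K)) (L : Submodule (𝓞 K) V) :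
    Submodule (𝓞 K) V where
  carrier := {x | ∃ s : 𝓞 K, s ∉ v.asIdeal ∧ s • x ∈ L}
  zero_mem' := ⟨1, v.isPrime.one_notMem, by simp⟩
  add_mem' := by
    rintro x y ⟨s, hs, hx⟩ ⟨t, ht, hy⟩
    refine ⟨s * t, v.isPrime.mul_notMem hs ht, ?_⟩
    rw [smul_add, mul_smul, mul_smul, smul_comm s t x]
    exact L.add_mem (L.smul_mem _ hx) (L.smul_mem _ hy)
  smul_mem' := by
    rintro c x ⟨s, hs, hx⟩
    exact ⟨s, hs, by rw [smul_comm]; exact L.smul_mem _ hx⟩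

lemma le_localizationAt (v : HeightOneSpectrum (𝓞 K)) (L : Submodule (𝓞 K) V) :
    L ≤ localizationAt v L := fun x hx => ⟨1, v.isPrime.one_notMem, by simpa using hx⟩

/-- The ideal of scalars sending `x` into `L` lies in no maximal ideal. -/
lemma mem_of_forall_mem_localizationAt [NumberField K] {L : Submodule (𝓞 K) V} {x : V}
    (hx : ∀ v, x ∈ localizationAt v L) : x ∈ L := by
  let I : Ideal (𝓞 K) := L.comap (LinearMap.toSpanSingleton (𝓞 K) V x)
  have hI : ∀ s, s ∈ I ↔ s • x ∈ L := fun s => Iff.rfl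
  by_cases htop : I = ⊤
  · simpa using (hI 1).mp (htop ▸ Submodule.mem_top)
  · obtain ⟨M, hM, hIM⟩ := Ideal.exists_le_maximal I htop
    have hM0 : M ≠ ⊥ := Ring.ne_bot_of_isMaximal_of_not_isField hM (RingOfIntegers.not_isField K)
    obtain ⟨s, hs, hsx⟩ := hx ⟨M, hM.isPrime, hM0⟩
    exact absurd (hIM ((hI s).mpr hsx)) hs

variable [Module K V]

/-- If `a • δ ∈ L` and `(a) = v^k b` with `b` prime to `v`, the Chinese remainder theorem gives a
scalar in `b` that is `1` modulo `v^k`; multiply `δ` by it. -/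
lemma exists_approximation [NumberField K] [IsScalarTower (𝓞 K) K V] {L : Submodule (𝓞 K) V}
    (hL : Submodule.span K (L : Set V) = ⊤) (v : HeightOneSpectrum (𝓞 K)) (δ : V) :
    ∃ y : V, y - δ ∈ localizationAt v L ∧ ∀ w, w ≠ v → y ∈ localizationAt w L := by
  obtain ⟨a, ha, haδ⟩ := exists_smul_mem_of_span_eq_top hL δ
  have ha' : Ideal.span {a} ≠ ⊥ := by simpa using ha
  obtain ⟨b, hb, hab⟩ := (FiniteMultiplicity.of_prime_left
    (Ideal.prime_of_isPrime v.ne_bot v.isPrime) ha').exists_eq_pow_mul_and_not_dvd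
  set k := multiplicity v.asIdeal (Ideal.span {a})
  have hmem : ∀ x ∈ v.asIdeal ^ k, ∀ y ∈ b, (x * y) • δ ∈ L := fun x hx y hy => by
    have : x * y ∈ Ideal.span {a} := hb ▸ Ideal.mul_mem_mul hx hy
    obtain ⟨r, hr⟩ := Ideal.mem_span_singleton'.mp this
    rw [← hr, mul_smul]
    exact L.smul_mem _ haδ
  have hbv : ¬ b ≤ v.asIdeal := fun h => hab (Ideal.dvd_iff_le.mpr h)
  have hcop : IsCoprime (v.asIdeal ^ k) b := by
    refine IsCoprime.pow_left (Ideal.isCoprime_iff_sup_eq.mpr ?_)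
    exact v.isMaximal.1.2 _ (left_lt_sup.mpr hbv)
  obtain ⟨x, hx, y, hy, hxy⟩ := Ideal.isCoprime_iff_exists.mp hcop
  refine ⟨y • δ, ?_, fun w hw => ?_⟩
  · obtain ⟨s, hsb, hsv⟩ := SetLike.not_le_iff_exists.mp hbv
    refine ⟨s, hsv, ?_⟩
    have : s • (y • δ - δ) = -((x * s) • δ) := by
      rw [eq_sub_of_add_eq hxy]
      module
    rw [this]
    exact L.neg_mem (hmem x hx s hsb)
  · have : ¬ v.asIdeal ^ k ≤ w.asIdeal := fun h => by
      have h' := w.isPrime.le_of_pow_le h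
      exact hw (HeightOneSpectrum.ext (v.isMaximal.eq_of_le w.isPrime.ne_top h').symm)
    obtain ⟨s, hsv, hsw⟩ := SetLike.not_le_iff_exists.mp this
    exact ⟨s, hsw, by rw [← mul_smul]; exact hmem s hsv y hy⟩

variable {F : Type*} [Field F] [Algebra K F] {R : Subring F} {L : Submodule (𝓞 K) V}

lemma one_tmul_mem_span [IsScalarTower (𝓞 K) K V] {x : V} {s : 𝓞 K} (hs : s ≠ 0) (hx : s • x ∈ L)
    (hsR : (algebraMap K F s)⁻¹ ∈ R) :
    (1 : F) ⊗ₜ[K] x ∈ Submodule.span R ((fun v : V => (1 : F) ⊗ₜ[K] v) '' (L : Set V)) := by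
  have hs' : (s : K) ≠ 0 := by simpa using hs
  have : (1 : F) ⊗ₜ[K] x = (⟨_, hsR⟩ : R) • ((1 : F) ⊗ₜ[K] (s • x)) := by
    change _ = (algebraMap K F s)⁻¹ • ((1 : F) ⊗ₜ[K] (s • x))
    rw [smul_eq_coe_smul, ← TensorProduct.smul_tmul, TensorProduct.smul_tmul', smul_eq_mul,
      Algebra.smul_def, mul_one, inv_mul_cancel₀]
    simpa using hs
  rw [this]
  exact Submodule.smul_mem _ _ (Submodule.subset_span ⟨_, hx, rfl⟩)

lemma locallyProperlyEquivalent_of_mem_span [FiniteDimensional K V] {B : LinearMap.BilinForm K V}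
    {σ : V ≃ₗ[K] V} (hσ : σ ∈ properOrthogonalGroup B) {ν μ : V}
    (h₁ : ∀ l ∈ L, (1 : F) ⊗ₜ[K] (σ l) ∈
      Submodule.span R ((fun v : V => (1 : F) ⊗ₜ[K] v) '' (L : Set V)))
    (h₂ : ∀ l ∈ L, (1 : F) ⊗ₜ[K] (σ.symm l) ∈
      Submodule.span R ((fun v : V => (1 : F) ⊗ₜ[K] v) '' (L : Set V)))
    (h₃ : (1 : F) ⊗ₜ[K] (μ - σ ν) ∈
      Submodule.span R ((fun v : V => (1 : F) ⊗ₜ[K] v) '' (L : Set V))) :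
    LocallyProperlyEquivalent R B L ν L μ := by
  set N := Submodule.span R ((fun v : V => (1 : F) ⊗ₜ[K] v) '' (L : Set V)) with hN
  set τ := σ.baseChange K F V V
  have key : ∀ ρ : (F ⊗[K] V) ≃ₗ[F] (F ⊗[K] V),
      (∀ l ∈ L, ρ ((1 : F) ⊗ₜ[K] l) ∈ N) → ∀ x ∈ N, ρ x ∈ N := fun ρ hρ x hx => by
    induction hx using Submodule.span_induction with
    | mem x hx =>
      obtain ⟨l, hl, rfl⟩ := hx
      exact hρ l hl
    | zero => rw [map_zero]; exact N.zero_mem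
    | add x y _ _ hx hy => rw [map_add]; exact N.add_mem hx hy
    | smul c x _ hx =>
      have : ρ (c • x) = c • ρ x := map_smul ρ (c : F) x
      rw [this]
      exact N.smul_mem c hx
  have hτ : ∀ x ∈ N, τ x ∈ N := key τ fun l hl => h₁ l hl
  have hτ' : ∀ x ∈ N, τ.symm x ∈ N := key τ.symm fun l hl => h₂ l hl
  have hτν : τ ((1 : F) ⊗ₜ[K] ν) = (1 : F) ⊗ₜ[K] (σ ν) := rfl
  rw [TensorProduct.tmul_sub] at h₃
  refine ⟨τ, baseChange_mem_properOrthogonalGroup hσ, Set.ext fun x => ⟨?_, ?_⟩⟩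
  · rintro ⟨l, hl, rfl⟩
    refine ⟨τ.symm (l + ((1 : F) ⊗ₜ[K] μ - (1 : F) ⊗ₜ[K] (σ ν))) + (1 : F) ⊗ₜ[K] ν,
      ⟨_, hτ' _ (N.add_mem hl h₃), rfl⟩, ?_⟩
    rw [map_add, LinearEquiv.apply_symm_apply, hτν]
    abel
  · rintro ⟨_, ⟨l, hl, rfl⟩, rfl⟩
    refine ⟨τ l - ((1 : F) ⊗ₜ[K] μ - (1 : F) ⊗ₜ[K] (σ ν)), N.sub_mem (hτ l hl) h₃, ?_⟩
    rw [map_add, hτν]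
    abel

lemma SkewEndomorphism.cayley_mem_localizationAt [IsScalarTower (𝓞 K) K V]
    {B : LinearMap.BilinForm K V} (S : SkewEndomorphism B L) {v : HeightOneSpectrum (𝓞 K)} {t : 𝓞 K}
    (ht : S.norm t ∉ v.asIdeal) {l : V} (hl : l ∈ L) : S.cayley t l ∈ localizationAt v L :=
  ⟨S.norm t, ht, by
    rw [S.norm_smul_cayley (by intro h; exact ht (h ▸ v.asIdeal.zero_mem))]
    exact S.linear_mem t (S.linear_mem t hl)⟩

variable [NumberField K] [IsScalarTower (𝓞 K) K V]

lemma one_tmul_mem_span_of_mem_localizationAt {v : HeightOneSpectrum (𝓞 K)} {x : V}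
    (hx : x ∈ localizationAt v L) :
    (1 : v.adicCompletion K) ⊗ₜ[K] x ∈ Submodule.span (v.adicCompletionIntegers K).toSubring
      ((fun y : V => (1 : v.adicCompletion K) ⊗ₜ[K] y) '' (L : Set V)) := by
  obtain ⟨s, hs, hsx⟩ := hx
  refine one_tmul_mem_span (s := s) (by rintro rfl; exact hs v.asIdeal.zero_mem) hsx ?_
  change _ ∈ v.adicCompletionIntegers K
  rw [HeightOneSpectrum.mem_adicCompletionIntegers, map_inv₀]
  have : Valued.v (algebraMap K (v.adicCompletion K) s) = 1 :=
    (HeightOneSpectrum.valuedAdicCompletion_eq_valuation' v (s : K)).trans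
      ((HeightOneSpectrum.valuation_eq_one_iff_notMem v).mpr hs)
  rw [this, inv_one]

/-- The local isometry is `σ` at `v` and the identity at every other place. At an archimedean place
the local lattice is the whole space, so there is no condition. -/
lemma shift_mem_properGenus [FiniteDimensional K V] {B : LinearMap.BilinForm K V}
    (hL : L.IsLattice K) {v : HeightOneSpectrum (𝓞 K)} {σ : V ≃ₗ[K] V}
    (hσ : σ ∈ properOrthogonalGroup B) {ν μ : V} (h₁ : ∀ l ∈ L, σ l ∈ localizationAt v L)
    (h₂ : ∀ l ∈ L, σ.symm l ∈ localizationAt v L) (h₃ : μ - σ ν ∈ localizationAt v L)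
    (h₄ : ∀ w, w ≠ v → μ - ν ∈ localizationAt w L) : shift L μ ∈ properGenus B L ν := by
  refine ⟨L, μ, hL, rfl, fun w => ?_, fun w => ?_⟩
  · by_cases hw : w = v
    · subst hw
      exact locallyProperlyEquivalent_of_mem_span hσ
        (fun l hl => one_tmul_mem_span_of_mem_localizationAt (h₁ l hl))
        (fun l hl => one_tmul_mem_span_of_mem_localizationAt (h₂ l hl))
        (one_tmul_mem_span_of_mem_localizationAt h₃)
    · have hl : ∀ l ∈ L, l ∈ localizationAt w L := fun l hl => le_localizationAt w L hl
      exact locallyProperlyEquivalent_of_mem_span (one_mem _)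
        (fun l h => one_tmul_mem_span_of_mem_localizationAt (hl l h))
        (fun l h => one_tmul_mem_span_of_mem_localizationAt (hl l h))
        (one_tmul_mem_span_of_mem_localizationAt (h₄ w hw))
  · have : ∀ x : V, (1 : w.Completion) ⊗ₜ[K] x ∈ Submodule.span (⊤ : Subring w.Completion)
        ((fun y : V => (1 : w.Completion) ⊗ₜ[K] y) '' (L : Set V)) := fun x => by
      obtain ⟨m, hm, hmx⟩ := exists_smul_mem_of_span_eq_top hL.span_eq_top x
      exact one_tmul_mem_span hm hmx (Subring.mem_top _)
    exact locallyProperlyEquivalent_of_mem_span (one_mem _) (fun l _ => this _) (fun l _ => this _)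
      (this _)

end Local

/-! ### Counting shifts of `L` in a genus -/

section Counting

variable {K V : Type*} [Field K] [AddCommGroup V] [Module (𝓞 K) V]

lemma shift_eq_shift_iff {L : Submodule (𝓞 K) V} {ν μ : V} :
    shift L ν = shift L μ ↔ ν - μ ∈ L := by
  constructor
  · intro h
    obtain ⟨l, hl, hlν⟩ : ν ∈ shift L μ := h ▸ ⟨0, L.zero_mem, by simp⟩
    rw [hlν, add_sub_cancel_right]
    exact hl
  · intro h
    ext x
    constructor
    · rintro ⟨l, hl, rfl⟩
      exact ⟨l + (ν - μ), L.add_mem hl h, by abel⟩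
    · rintro ⟨l, hl, rfl⟩
      exact ⟨l - (ν - μ), L.sub_mem hl h, by abel⟩

variable [Module K V]

/-- `L` is the set of differences of elements of any of its shifts. -/
lemma map_mem_of_shift_eq_image {L : Submodule (𝓞 K) V} {ν μ : V} {τ : V ≃ₗ[K] V}
    (h : shift L μ = τ '' shift L ν) {l : V} (hl : l ∈ L) : τ l ∈ L := by
  obtain ⟨a, ha, ha'⟩ : τ (l + ν) ∈ shift L μ := h ▸ ⟨_, ⟨l, hl, rfl⟩, rfl⟩
  obtain ⟨b, hb, hb'⟩ : τ ν ∈ shift L μ := h ▸ ⟨_, ⟨0, L.zero_mem, (zero_add ν).symm⟩, rfl⟩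
  have : τ l = a - b := by
    rw [map_add, hb'] at ha'
    rw [eq_sub_iff_add_eq]
    exact add_right_cancel ((add_assoc _ _ _).trans ha')
  rw [this]
  exact L.sub_mem ha hb

/-- If the automorphisms in `O⁺(V)` preserving `L` form a finite set `G`, then a genus with at most
`h` proper classes contains at most `h * |G|` shifts of `L`. -/
lemma card_le_of_shift_mem_properGenus [NumberField K] [IsScalarTower (𝓞 K) K V]
    {B : LinearMap.BilinForm K V} {L : Submodule (𝓞 K) V}
    {G : Finset (V ≃ₗ[K] V)} (hG : ∀ τ ∈ properOrthogonalGroup B, (∀ l ∈ L, τ l ∈ L) → τ ∈ G)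
    {ν : V} {h : ℕ} (hh : properClassNumber B L ν = h) {ι : Type*} {T : Finset ι} {μ : ι → V}
    (hμ : ∀ t ∈ T, shift L (μ t) ∈ properGenus B L ν)
    (hinj : ∀ s ∈ T, ∀ t ∈ T, μ s - μ t ∈ L → s = t) : T.card ≤ h * G.card := by
  classical
  have hfin : (properClass B '' properGenus B L ν).Finite := Set.finite_of_encard_eq_coe hh
  have hcard : hfin.toFinset.card = h := by
    have : (hfin.toFinset.card : ℕ∞) = h := by
      rw [← hh, properClassNumber, hfin.encard_eq_coe_toFinset_card]
    exact_mod_cast this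
  rw [← hcard, mul_comm]
  refine Finset.card_le_mul_card_image_of_maps_to (f := fun t => properClass B (shift L (μ t)))
    (fun t ht => hfin.mem_toFinset.mpr ⟨_, hμ t ht, rfl⟩) _ fun c hc => ?_
  rcases (T.filter fun t => properClass B (shift L (μ t)) = c).eq_empty_or_nonempty with he | ⟨s, hs⟩
  · rw [he]
    exact Nat.zero_le _
  -- Fix one shift `s` in the class. Every other one is its image under some `τ ∈ G`, and `τ`
  -- determines the shift.
  · have hex : ∀ t ∈ T.filter fun t => properClass B (shift L (μ t)) = c,
        ∃ τ ∈ G, shift L (μ t) = τ '' shift L (μ s) := by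
      intro t ht
      have hmem : shift L (μ t) ∈ properClass B (shift L (μ s)) := by
        rw [(Finset.mem_filter.mp hs).2, ← (Finset.mem_filter.mp ht).2]
        exact ⟨1, one_mem _, by simp⟩
      obtain ⟨τ, hτ, hτs⟩ := hmem
      exact ⟨τ, hG τ hτ fun l hl => map_mem_of_shift_eq_image hτs hl, hτs⟩
    choose! τ hτG hτ using hex
    refine Finset.card_le_card_of_injOn τ hτG fun t ht t' ht' htt' => ?_
    refine hinj t (Finset.mem_filter.mp ht).1 t' (Finset.mem_filter.mp ht').1 ?_
    rw [← shift_eq_shift_iff, hτ t ht, hτ t' ht', htt']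

end Counting

/-! ### A uniform annihilator of `ν` modulo `L` -/

section Conductor

variable {K V : Type*} [Field K] [NumberField K] [AddCommGroup V] [Module K V] [Module (𝓞 K) V]
  {B : LinearMap.BilinForm K V} {L : Submodule (𝓞 K) V}

/-- The shift `L + ν` depends only on the class of `e • ν` in the finite quotient `L / eL`. -/
lemma finite_setOf_smul_mem [IsScalarTower (𝓞 K) K V] (hL : L.FG) {e : 𝓞 K} (he : e ≠ 0) :
    {X : Set V | ∃ ν, X = shift L ν ∧ e • ν ∈ L}.Finite := by
  have he' : (e : K) ≠ 0 := by simpa using he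
  have : Finite (𝓞 K ⧸ Ideal.span {e}) :=
    Ring.HasFiniteQuotients.finiteQuotient (by simpa using he)
  have : Module.Finite (𝓞 K) L := .of_fg hL
  have : Finite (L ⧸ (Ideal.span {e} • ⊤ : Submodule (𝓞 K) L)) :=
    Submodule.finite_quotient_smul _ Module.Finite.fg_top
  refine (Set.finite_range fun q : L ⧸ (Ideal.span {e} • ⊤ : Submodule (𝓞 K) L) =>
    shift L ((e : K)⁻¹ • ((Quotient.out q : L) : V))).subset ?_
  rintro _ ⟨ν, rfl, hν⟩
  refine ⟨Submodule.Quotient.mk ⟨e • ν, hν⟩, ?_⟩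
  rw [shift_eq_shift_iff]
  set y : L := Quotient.out (Submodule.Quotient.mk
    (p := (Ideal.span {e} • ⊤ : Submodule (𝓞 K) L)) ⟨e • ν, hν⟩)
  have hy : y - ⟨e • ν, hν⟩ ∈ (Ideal.span {e} • ⊤ : Submodule (𝓞 K) L) := by
    rw [← Submodule.Quotient.eq]
    exact Quotient.out_eq _
  rw [Submodule.ideal_span_singleton_smul] at hy
  obtain ⟨z, -, hz⟩ := hy
  have hz' : e • (z : V) = y - e • ν := congrArg Subtype.val hz
  have : (e : K)⁻¹ • (y : V) - ν = z := by
    rw [← sub_eq_zero, ← smul_eq_zero_iff_right he', ← smul_eq_coe_smul]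
    rw [smul_sub, smul_sub, hz', smul_eq_coe_smul, smul_inv_smul₀ he']
    abel
  rw [this]
  exact z.2

namespace SkewEndomorphism

variable (S : SkewEndomorphism B L)

/-- An element annihilating every `ν` modulo `L` that has two congruent Cayley transforms with
parameters in `T`. -/
def conductor (T : Finset (𝓞 K)) : 𝓞 K :=
  2 * S.d * ∏ st ∈ T.offDiag, (st.2 - st.1)

lemma conductor_ne_zero (T : Finset (𝓞 K)) : S.conductor T ≠ 0 := by
  refine mul_ne_zero (mul_ne_zero two_ne_zero S.d_ne_zero) (Finset.prod_ne_zero_iff.mpr ?_)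
  rintro ⟨s, t⟩ h
  exact sub_ne_zero.mpr (Finset.mem_offDiag.mp h).2.2.symm

/-- Each finite place contains arbitrarily many parameters of locally integral Cayley transforms. -/
lemma exists_finset_norm_notMem (v : HeightOneSpectrum (𝓞 K)) (N : ℕ) :
    ∃ T : Finset (𝓞 K), T.card = N ∧ ∀ t ∈ T, S.norm t ∉ v.asIdeal := by
  have hinf : (v.asIdeal : Set (𝓞 K)).Infinite := by
    obtain ⟨a, ha, ha0⟩ := Submodule.exists_mem_ne_zero_of_ne_bot v.ne_bot
    exact (Set.infinite_range_of_injective (mul_right_injective₀ ha0)).mono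
      (by rintro _ ⟨b, rfl⟩; exact v.asIdeal.mul_mem_right b ha)
  obtain ⟨T, hTv, hT⟩ := hinf.exists_subset_card_eq N
  refine ⟨T, hT, fun t ht hn => ?_⟩
  -- For `t` in the prime, `1 + t²d ≡ 1`, so infinitely many parameters are available.
  have htv : t ∈ v.asIdeal := hTv ht
  have h2 : t ^ 2 * S.d ∈ v.asIdeal :=
    v.asIdeal.mul_mem_right _ (v.asIdeal.pow_mem_of_mem htv 2 two_pos)
  exact v.isPrime.one_notMem ((Submodule.add_mem_iff_left _ h2).mp hn)

/-- The set chosen for one place `v₀` serves every place not dividing the product of its norms. The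
finitely many exceptions get their own sets, and `e` is the product of all these conductors. -/
lemma exists_ne_zero_forall_exists_conductor_dvd (N : ℕ) :
    ∃ e : 𝓞 K, e ≠ 0 ∧ ∀ v : HeightOneSpectrum (𝓞 K), ∃ T : Finset (𝓞 K), T.card = N ∧
      (∀ t ∈ T, S.norm t ∉ v.asIdeal) ∧ S.conductor T ∣ e := by
  classical
  choose T hTcard hT using fun v => S.exists_finset_norm_notMem v N
  by_cases hne : Nonempty (HeightOneSpectrum (𝓞 K))
  swap
  · exact ⟨1, one_ne_zero, fun v => (hne ⟨v⟩).elim⟩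
  obtain ⟨v₀⟩ := hne
  have hprod : Ideal.span {∏ t ∈ T v₀, S.norm t} ≠ ⊥ := by
    rw [Ne, Ideal.span_singleton_eq_bot, Finset.prod_eq_zero_iff]
    rintro ⟨t, ht, h0⟩
    exact hT v₀ t ht (h0 ▸ v₀.asIdeal.zero_mem)
  have hbad := Ideal.finite_factors hprod
  refine ⟨S.conductor (T v₀) * ∏ v ∈ hbad.toFinset, S.conductor (T v), ?_, fun v => ?_⟩
  · exact mul_ne_zero (S.conductor_ne_zero _)
      (Finset.prod_ne_zero_iff.mpr fun v _ => S.conductor_ne_zero _)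
  · by_cases hv : v ∈ hbad.toFinset
    · exact ⟨T v, hTcard v, hT v,
        (Finset.dvd_prod_of_mem (fun v => S.conductor (T v)) hv).mul_left _⟩
    · refine ⟨T v₀, hTcard v₀, fun t ht htv => hv ?_, Dvd.intro _ rfl⟩
      rw [Set.Finite.mem_toFinset, Set.mem_ofPred_eq, Ideal.dvd_iff_le,
        Ideal.span_singleton_le_iff_mem]
      exact Ideal.mem_of_dvd _ (Finset.dvd_prod_of_mem S.norm ht) htv

variable [IsScalarTower (𝓞 K) K V]

lemma conductor_smul_mem {v : HeightOneSpectrum (𝓞 K)} {T : Finset (𝓞 K)}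
    (hT : ∀ t ∈ T, S.norm t ∉ v.asIdeal) {s t : 𝓞 K} (hs : s ∈ T) (ht : t ∈ T) (hst : s ≠ t)
    {ν : V} (h : S.cayley s ν - S.cayley t ν ∈ localizationAt v L) :
    S.conductor T • ν ∈ localizationAt v L := by
  have hne : ∀ t ∈ T, S.norm t ≠ 0 := fun t ht h0 => hT t ht (h0 ▸ v.asIdeal.zero_mem)
  obtain ⟨c, hc, hcL⟩ := h
  have hmem : (2 * (t - s) * S.d) • ν ∈ localizationAt v L := by
    refine ⟨c, hc, ?_⟩
    have := S.map_mem _ (S.linear_mem (-s) (S.linear_mem (-t) hcL))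
    rw [smul_eq_coe_smul, map_smul, map_smul, map_smul,
      S.J_linear_linear_cayley_sub (hne s hs) (hne t ht)] at this
    rw [smul_eq_coe_smul, smul_eq_coe_smul]
    have hcast : algebraMap (𝓞 K) K (2 * (t - s) * S.d) =
        2 * (algebraMap (𝓞 K) K t - algebraMap (𝓞 K) K s) * algebraMap (𝓞 K) K S.d := by
      rw [map_mul, map_mul, map_sub, map_ofNat]
    rw [show ((2 * (t - s) * S.d : 𝓞 K) : K) = _ from hcast]
    exact this
  obtain ⟨r, hr⟩ : t - s ∣ ∏ st ∈ T.offDiag, (st.2 - st.1) :=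
    Finset.dvd_prod_of_mem (fun st : 𝓞 K × 𝓞 K => st.2 - st.1)
      (a := (s, t)) (Finset.mem_offDiag.mpr ⟨hs, ht, hst⟩)
  have : S.conductor T = r * (2 * (t - s) * S.d) := by
    rw [conductor, hr]
    ring
  rw [this, mul_smul]
  exact Submodule.smul_mem _ _ hmem

/-- Otherwise the approximations to `σ_t ν`, for `t ∈ T`, would give more shifts of `L` in the genus
than the count `h * |G|` allows. -/
lemma exists_cayley_sub_cayley_mem (hdim : Module.finrank K V = 2) (hL : L.IsLattice K)
    {G : Finset (V ≃ₗ[K] V)} (hG : ∀ τ ∈ properOrthogonalGroup B, (∀ l ∈ L, τ l ∈ L) → τ ∈ G)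
    {ν : V} {h : ℕ} (hh : properClassNumber B L ν = h) {v : HeightOneSpectrum (𝓞 K)}
    {T : Finset (𝓞 K)} (hT : ∀ t ∈ T, S.norm t ∉ v.asIdeal) (hcard : h * G.card < T.card) :
    ∃ s ∈ T, ∃ t ∈ T, s ≠ t ∧ S.cayley s ν - S.cayley t ν ∈ localizationAt v L := by
  have : FiniteDimensional K V := FiniteDimensional.of_finrank_pos (by omega)
  choose y hyv hyw using fun t => exists_approximation hL.span_eq_top v (S.cayley t ν - ν)
  by_contra! hcon
  refine hcard.not_ge (card_le_of_shift_mem_properGenus hG hh (μ := fun t => ν + y t)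
    (fun t ht => ?_) fun s hs t ht hst => ?_)
  · have hn : S.norm t ≠ 0 := fun h0 => hT t ht (h0 ▸ v.asIdeal.zero_mem)
    refine shift_mem_properGenus hL (v := v) (S.cayleyEquiv_mem hdim hn)
      (fun l hl => S.cayley_mem_localizationAt (hT t ht) hl)
      (fun l hl => S.cayley_mem_localizationAt (by rw [S.norm_neg]; exact hT t ht) hl) ?_
      fun w hw => ?_
    · convert hyv t using 1
      rw [cayleyEquiv_apply]
      abel
    · rw [add_sub_cancel_left]
      exact hyw t w hw
  · by_contra hne
    refine hcon s hs t ht hne ?_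
    have := (localizationAt v L).add_mem ((localizationAt v L).sub_mem (hyv t) (hyv s))
      (le_localizationAt v L hst)
    convert this using 1
    abel

end SkewEndomorphism

end Conductor

end ShiftedLattice

theorem corollary1p3 {K V : Type*} [Field K] [NumberField K] [NumberField.IsTotallyReal K]
    [AddCommGroup V] [Module K V] [Module (𝓞 K) V] [IsScalarTower (𝓞 K) K V]
    (hdim : Module.finrank K V = 2)
    (B : LinearMap.BilinForm K V) (hsymm : B.IsSymm) (hnondeg : B.Nondegenerate)
    (hpos : ShiftedLattice.IsTotallyPositive B)
    (L : Submodule (𝓞 K) V) (hL : L.IsLattice K)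
    (h : ℕ) (hh : 1 ≤ h) :
    {X : Set V | ∃ ν : V, X = ShiftedLattice.shift L ν ∧
      ShiftedLattice.properClassNumber B L ν = h}.Finite := by
  obtain ⟨S⟩ := ShiftedLattice.exists_skewEndomorphism hdim hsymm hpos hL
  have hG := hpos.finite_setOf_properOrthogonalGroup_mem hdim hsymm hL
  -- One parameter more than the largest possible number of shifts of `L` in the genus, so that the
  -- pigeonhole applies.
  obtain ⟨e, he, heT⟩ :=
    S.exists_ne_zero_forall_exists_conductor_dvd (h * hG.toFinset.card + 1)
  refine (ShiftedLattice.finite_setOf_smul_mem hL.fg he).subset ?_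
  rintro X ⟨ν, rfl, hν⟩
  refine ⟨ν, rfl, ShiftedLattice.mem_of_forall_mem_localizationAt fun v => ?_⟩
  obtain ⟨T, hTcard, hT, r, hr⟩ := heT v
  obtain ⟨s, hs, t, ht, hst, hmem⟩ := S.exists_cayley_sub_cayley_mem hdim hL (G := hG.toFinset)
    (fun τ hτ hτL => hG.mem_toFinset.mpr ⟨hτ, hτL⟩) hν hT (by omega)
  rw [hr, mul_comm, mul_smul]
  exact Submodule.smul_mem _ _ (S.conductor_smul_mem hT hs ht hst hmem)
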